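/- Let $s\in\{0,\tfrac12,1,\tfrac32,\dots\}$ and $N\in\{0,1,2,\dots\}$. Let $\mathbf s=(s_1,s_2,s_3)$ be the spin operators on $\mathbb C^{2s+1}$ in the orthonormal basis $|m\rangle$, $m=s,s-1,\dots,-s$, that is, $s_3|m\rangle=m|m\rangle$ and $(s_1\pm i s_2)|m\rangle=\sqrt{s(s+1)-m(m\pm1)}\,|m\pm1\rangle$. Let $g\mapsto U^{(s)}_g$ be the irreducible unitary representation of $SU(2)$ on $\mathbb C^{2s+1}$ with generators $s_1,s_2,s_3$, that is, $U^{(s)}_{\exp(-\frac i2 x\cdot\sigma)}=\exp(-i\,x\cdot\mathbf s)$ for $x\in\mathbb R^3$, where $\sigma_1,\sigma_2,\sigma_3$ are the Pauli matrices. Let $U_g=U^{(s)}_g\otimes\cdots\otimes U^{(s)}_g$ ($N$ factors), acting on $\mathcal H=(\mathbb C^{2s+1})^{\otimes N}$. For $g\in SU(2)$ let $R_g\in SO(3)$ be the rotation with $g\,(x\cdot\sigma)\,g^*=(R_gx)\cdot\sigma$ for all $x\in\mathbb R^3$; it also satisfies $U^{(s)}_g(x\cdot\mathbf s)(U^{(s)}_g)^*=(R_gx)\cdot\mathbf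 s$. It acts on the phase space $\mathcal S=(\mathbb S^2)^N$ by $R_g(\Omega_1,\dots,\Omega_N)=(R_g\Omega_1,\dots,R_g\Omega_N)$. For a point of $\mathbb S^2$ with polar angle $\theta$ and azimuth $\varphi$ (put $\varphi=0$ at the poles), the coherent state is $$|\Omega\rangle=\sum_{m=-s}^{s}\binom{2s}{s+m}^{1/2}\Big(\cos\frac\theta2\Big)^{s+m}\Big(\sin\frac\theta2\Big)^{s-m}e^{i(s-m)\varphi}\,|m\rangle ,$$ and for $\Omega=(\Omega_1,\dots,\Omega_N)\in\mathcal S$ put $|\Omega\rangle=|\Omega_1\rangle\otimes\cdots\otimes|\Omega_N\rangle\in\mathcal H$. Equip $\mathcal S$ with the measure $\tilde d\Omega=\big(\frac{2s+1}{4\pi}\big)^N d\Omega_1\cdots d\Omega_N$, where $d\Omega_\mu$ is the surface measure of $\mathbb S^2$. Let $j:\mathcal H\to L^2(\mathcal S,\tilde d\Omega)$, $(j\varphi)(\Omega)=\langle\Omega|\varphi\rangle$. For a complex-valued $F\in L^\infty(\mathcal S,\tilde d\Omega)$ let $\hat F$ be the operator of multiplication by $F$ on $L^2(\mathcal S,\tilde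 d\Omega)$, and put $A(F)=j^*\hat F j:\mathcal H\to\mathcal H$. Proposition 5.2. For every $g\in SU(2)$ and every $F\in L^\infty(\mathcal S,\tilde d\Omega)$, the function $F\circ R_g^{-1}$ is in $L^\infty(\mathcal S,\tilde d\Omega)$ and $$A(F\circ R_g^{-1})=U_g\,A(F)\,U_g^* .$$ -/

import Mathlib

open MeasureTheory
open scoped ENNReal

noncomputable section

namespace SpinCoherent

/-! ### The spin-`s` representation of `SU(2)`

Throughout, `n : ℕ` stands for `2 s`, where `s = n / 2` is the integer or half-integer spin quantum
number.  The index `k : Fin (n + 1)` stands for the eigenvector `|m⟩` of the third spin operator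
with `m = s - k`, so that `k = 0` is the highest weight vector `|s⟩`. -/

/-- The group `SU(2)`. -/
abbrev SU2 : Type := Matrix.specialUnitaryGroup (Fin 2) ℂ

/-- The group `SO(3)`. -/
abbrev SO3 : Type := Matrix.specialOrthogonalGroup (Fin 3) ℝ

/-- The magnetic quantum number `m = s - k` of the basis vector with index `k`. -/
def magnetic (n : ℕ) (k : Fin (n + 1)) : ℝ := (n : ℝ) / 2 - (k : ℕ)

/-- The raising operator: `s₊ |m⟩ = √(s (s + 1) - m (m + 1)) |m + 1⟩`. -/
def spinPlus (n : ℕ) : Matrix (Fin (n + 1)) (Fin (n + 1)) ℂ :=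
  Matrix.of fun j k => if (j : ℕ) + 1 = k then
    ((Real.sqrt ((n : ℝ) / 2 * ((n : ℝ) / 2 + 1) - magnetic n k * (magnetic n k + 1)) : ℝ) : ℂ)
    else 0

/-- The lowering operator: `s₋ |m⟩ = √(s (s + 1) - m (m - 1)) |m - 1⟩`. -/
def spinMinus (n : ℕ) : Matrix (Fin (n + 1)) (Fin (n + 1)) ℂ :=
  Matrix.of fun j k => if (j : ℕ) = k + 1 then
    ((Real.sqrt ((n : ℝ) / 2 * ((n : ℝ) / 2 + 1) - magnetic n k * (magnetic n k - 1)) : ℝ) : ℂ)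
    else 0

/-- The spin operators `s₁, s₂, s₃`, where `s₃ |m⟩ = m |m⟩` and `s_± = s₁ ± i s₂`. -/
def spinOp (n : ℕ) : Fin 3 → Matrix (Fin (n + 1)) (Fin (n + 1)) ℂ :=
  ![(1 / 2 : ℂ) • (spinPlus n + spinMinus n),
    (-Complex.I / 2) • (spinPlus n - spinMinus n),
    Matrix.diagonal fun k => (magnetic n k : ℂ)]

/-- The operator `x · s = ∑ᵢ xᵢ sᵢ` for `x ∈ ℝ³`. -/
def dotSpin (n : ℕ) (x : Fin 3 → ℝ) : Matrix (Fin (n + 1)) (Fin (n + 1)) ℂ :=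
  ∑ i, (x i : ℂ) • spinOp n i

/-- The Pauli matrices. -/
def pauli : Fin 3 → Matrix (Fin 2) (Fin 2) ℂ :=
  ![!![0, 1; 1, 0], !![0, -Complex.I; Complex.I, 0], !![1, 0; 0, -1]]

/-- The matrix `x · σ = ∑ᵢ xᵢ σᵢ` for `x ∈ ℝ³`. -/
def dotPauli (x : Fin 3 → ℝ) : Matrix (Fin 2) (Fin 2) ℂ := ∑ i, (x i : ℂ) • pauli i

/-- The matrix of the action of a `2 × 2` matrix `M` on binary forms of degree `n`, by the
substitution `X ↦ M₀₀ X + M₁₀ Y`, `Y ↦ M₀₁ X + M₁₁ Y`, with respect to the basis of the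
monomials `√(n choose k) X ^ (n - k) Y ^ k`; the variable `X` is set to `1`. -/
def spinMatrix (n : ℕ) (M : Matrix (Fin 2) (Fin 2) ℂ) : Matrix (Fin (n + 1)) (Fin (n + 1)) ℂ :=
  Matrix.of fun j k =>
    ((Real.sqrt (n.choose k) / Real.sqrt (n.choose j) : ℝ) : ℂ) *
      ((Polynomial.C (M 0 0) + Polynomial.C (M 1 0) * Polynomial.X) ^ (n - (k : ℕ)) *
        (Polynomial.C (M 0 1) + Polynomial.C (M 1 1) * Polynomial.X) ^ (k : ℕ)).coeff j

/-- The `n`-th power of a spinor `z ∈ ℂ²`, in the same basis. -/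
def spinorPow (n : ℕ) (z : Fin 2 → ℂ) : Fin (n + 1) → ℂ :=
  fun j => (Real.sqrt (n.choose j) : ℂ) * z 0 ^ (n - (j : ℕ)) * z 1 ^ (j : ℕ)

theorem sqrt_choose_ne_zero (n : ℕ) (j : Fin (n + 1)) : (Real.sqrt (n.choose j) : ℂ) ≠ 0 := by
  have : 0 < n.choose j := Nat.choose_pos (Nat.lt_succ_iff.mp j.2)
  have h : 0 < Real.sqrt (n.choose j) := Real.sqrt_pos.mpr (by exact_mod_cast this)
  exact_mod_cast h.ne'

theorem sqrt_choose_mul_self (n : ℕ) (j : ℕ) :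
    (Real.sqrt (n.choose j) : ℂ) * (Real.sqrt (n.choose j) : ℂ) = n.choose j := by
  rw [← Complex.ofReal_mul, Real.mul_self_sqrt (Nat.cast_nonneg _), Complex.ofReal_natCast]

theorem coeff_linear_pow (n : ℕ) (a b : ℂ) (j : ℕ) :
    ((Polynomial.C a + Polynomial.C b * Polynomial.X) ^ n).coeff j =
      n.choose j * a ^ (n - j) * b ^ j := by
  rw [add_comm, add_pow, Polynomial.finsetSum_coeff]
  have : ∀ m ∈ Finset.range (n + 1),
      ((Polynomial.C b * Polynomial.X) ^ m * Polynomial.C a ^ (n - m) *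
        ((n.choose m : ℕ) : Polynomial ℂ)).coeff j =
      if j = m then (n.choose j : ℂ) * a ^ (n - j) * b ^ j else 0 := by
    intro m _
    rw [show (Polynomial.C b * Polynomial.X) ^ m * Polynomial.C a ^ (n - m) *
        ((n.choose m : ℕ) : Polynomial ℂ) =
        Polynomial.C (n.choose m * a ^ (n - m) * b ^ m) * Polynomial.X ^ m by
      simp only [map_mul, map_pow, map_natCast]; ring]
    rw [Polynomial.coeff_C_mul, Polynomial.coeff_X_pow]
    split_ifs with h
    · subst h; simp
    · simp
  rw [Finset.sum_congr rfl this, Finset.sum_ite_eq]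
  split_ifs with h
  · rfl
  · rw [Nat.choose_eq_zero_of_lt (by simpa using h)]; simp

theorem spinMatrix_mulVec_spinorPow (n : ℕ) (M : Matrix (Fin 2) (Fin 2) ℂ) (z : Fin 2 → ℂ) :
    (spinMatrix n M).mulVec (spinorPow n z) = spinorPow n (M.mulVec z) := by
  funext j
  have hj := sqrt_choose_ne_zero n j
  have key := coeff_linear_pow n (M.mulVec z 0) (M.mulVec z 1) j
  have e : Polynomial.C (M.mulVec z 0) + Polynomial.C (M.mulVec z 1) * Polynomial.X =
      Polynomial.C (z 1) * (Polynomial.C (M 0 1) + Polynomial.C (M 1 1) * Polynomial.X) +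
      Polynomial.C (z 0) * (Polynomial.C (M 0 0) + Polynomial.C (M 1 0) * Polynomial.X) := by
    simp only [Matrix.mulVec, dotProduct, Fin.sum_univ_two, map_add, map_mul]; ring
  rw [e, add_pow, Polynomial.finsetSum_coeff, Finset.sum_range] at key
  have lhs : (spinMatrix n M).mulVec (spinorPow n z) j =
      (Real.sqrt (n.choose j) : ℂ)⁻¹ * (n.choose j * (M.mulVec z 0) ^ (n - (j : ℕ)) *
        (M.mulVec z 1) ^ (j : ℕ)) := by
    rw [← key, Finset.mul_sum]
    change ∑ k, spinMatrix n M j k * spinorPow n z k = _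
    refine Finset.sum_congr rfl fun k _ => ?_
    rw [show (Polynomial.C (z 1) * (Polynomial.C (M 0 1) + Polynomial.C (M 1 1) * Polynomial.X))
          ^ (k : ℕ) *
        (Polynomial.C (z 0) * (Polynomial.C (M 0 0) + Polynomial.C (M 1 0) * Polynomial.X))
          ^ (n - (k : ℕ)) * ((n.choose k : ℕ) : Polynomial ℂ) =
        Polynomial.C (n.choose k * z 0 ^ (n - (k : ℕ)) * z 1 ^ (k : ℕ)) *
        ((Polynomial.C (M 0 0) + Polynomial.C (M 1 0) * Polynomial.X) ^ (n - (k : ℕ)) *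
        (Polynomial.C (M 0 1) + Polynomial.C (M 1 1) * Polynomial.X) ^ (k : ℕ)) by
      simp only [map_mul, map_pow, map_natCast, mul_pow]; ring]
    rw [Polynomial.coeff_C_mul, ← sqrt_choose_mul_self]
    simp only [spinMatrix, spinorPow, Matrix.of_apply, Complex.ofReal_div]
    ring
  rw [lhs, ← sqrt_choose_mul_self]
  simp only [spinorPow]
  field_simp

/-- The powers of spinors span the whole space. -/
theorem span_spinorPow (n : ℕ) : Submodule.span ℂ (Set.range (spinorPow n)) = ⊤ := by
  by_contra h
  obtain ⟨f, hf, hle⟩ := Submodule.exists_le_ker_of_lt_top _ (lt_top_iff_ne_top.mpr h)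
  apply hf
  have h0 : ∀ x : ℂ, ∑ j : Fin (n + 1),
      (Real.sqrt (n.choose j) : ℂ) * f (Pi.single j 1) * x ^ (j : ℕ) = 0 := by
    intro x
    have h1 : f (spinorPow n ![1, x]) = 0 :=
      hle (Submodule.subset_span ⟨_, rfl⟩)
    rw [LinearMap.pi_apply_eq_sum_univ] at h1
    rw [← h1]
    refine Finset.sum_congr rfl fun j _ => ?_
    have : (fun i => if j = i then (1 : ℂ) else 0) = Pi.single j 1 := by
      funext i; simp [Pi.single_apply, eq_comm]
    rw [this]
    simp [spinorPow]
    ring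
  let p : Polynomial ℂ := ∑ j : Fin (n + 1),
    Polynomial.C ((Real.sqrt (n.choose j) : ℂ) * f (Pi.single j 1)) * Polynomial.X ^ (j : ℕ)
  have hp : p = 0 := by
    apply Polynomial.funext
    intro x
    simp only [p, Polynomial.eval_finsetSum, Polynomial.eval_mul, Polynomial.eval_C,
      Polynomial.eval_pow, Polynomial.eval_X, Polynomial.eval_zero]
    exact h0 x
  apply LinearMap.pi_ext'
  intro j
  apply LinearMap.ext_ring
  have hc : p.coeff j = (Real.sqrt (n.choose j) : ℂ) * f (Pi.single j 1) := by
    simp only [p, Polynomial.finsetSum_coeff, Polynomial.coeff_C_mul, Polynomial.coeff_X_pow]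
    rw [Finset.sum_eq_single j]
    · simp
    · intro b _ hb
      rw [if_neg (fun h => hb (Fin.ext h.symm)), mul_zero]
    · simp
  rw [hp, Polynomial.coeff_zero] at hc
  have := (mul_eq_zero.mp hc.symm).resolve_left (sqrt_choose_ne_zero n j)
  simpa using this

theorem matrix_ext_spinorPow {n : ℕ} {A B : Matrix (Fin (n + 1)) (Fin (n + 1)) ℂ}
    (h : ∀ z, A.mulVec (spinorPow n z) = B.mulVec (spinorPow n z)) : A = B := by
  apply Matrix.toLin'.injective
  apply LinearMap.ext_on_range (span_spinorPow n)
  intro z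
  simpa using h z

theorem spinMatrix_one (n : ℕ) : spinMatrix n 1 = 1 :=
  matrix_ext_spinorPow fun z => by simp [spinMatrix_mulVec_spinorPow]

theorem spinMatrix_mul (n : ℕ) (A B : Matrix (Fin 2) (Fin 2) ℂ) :
    spinMatrix n (A * B) = spinMatrix n A * spinMatrix n B :=
  matrix_ext_spinorPow fun z => by
    simp [spinMatrix_mulVec_spinorPow, ← Matrix.mulVec_mulVec]

theorem star_spinorPow_dotProduct (n : ℕ) (w z : Fin 2 → ℂ) :
    star (spinorPow n w) ⬝ᵥ spinorPow n z = (star w ⬝ᵥ z) ^ n := by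
  simp only [dotProduct, Fin.sum_univ_two, Pi.star_apply]
  rw [add_comm (star (w 0) * z 0), add_pow, Finset.sum_range]
  refine Finset.sum_congr rfl fun j _ => ?_
  rw [← sqrt_choose_mul_self]
  simp only [spinorPow, star_mul', star_pow, mul_pow]
  have : star (Real.sqrt (n.choose j) : ℂ) = (Real.sqrt (n.choose j) : ℂ) := Complex.conj_ofReal _
  rw [this]
  ring

theorem spinMatrix_conjTranspose (n : ℕ) (M : Matrix (Fin 2) (Fin 2) ℂ) :
    spinMatrix n M.conjTranspose = (spinMatrix n M).conjTranspose := by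
  apply matrix_ext_spinorPow
  intro z
  have key : ∀ w, star (spinorPow n w) ⬝ᵥ
      ((spinMatrix n M.conjTranspose).mulVec (spinorPow n z) -
        (spinMatrix n M).conjTranspose.mulVec (spinorPow n z)) = 0 := by
    intro w
    rw [dotProduct_sub, spinMatrix_mulVec_spinorPow, star_spinorPow_dotProduct,
      Matrix.dotProduct_mulVec _ (spinMatrix n M).conjTranspose, ← Matrix.star_mulVec,
      spinMatrix_mulVec_spinorPow, star_spinorPow_dotProduct, Matrix.star_mulVec,
      ← Matrix.dotProduct_mulVec, sub_self]
  set d := (spinMatrix n M.conjTranspose).mulVec (spinorPow n z) -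
        (spinMatrix n M).conjTranspose.mulVec (spinorPow n z) with hd
  have all : ∀ u : Fin (n + 1) → ℂ, star u ⬝ᵥ d = 0 := by
    intro u
    have hu : u ∈ Submodule.span ℂ (Set.range (spinorPow n)) := by
      rw [span_spinorPow]; trivial
    induction hu using Submodule.span_induction with
    | mem x hx => obtain ⟨w, rfl⟩ := hx; exact key w
    | zero => simp
    | add x y _ _ hx hy => rw [star_add, add_dotProduct, hx, hy, add_zero]
    | smul c x _ hx => rw [star_smul, smul_dotProduct, hx, smul_zero]
  have hd0 : d = 0 := by
    funext j
    have := all (Pi.single j 1)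
    rwa [← Pi.single_star, star_one, single_one_dotProduct] at this
  exact sub_eq_zero.mp hd0

theorem sqrt_plus_eq (n j : ℕ) (hj : j < n) :
    ((Real.sqrt ((n : ℝ) / 2 * ((n : ℝ) / 2 + 1) -
      ((n : ℝ) / 2 - (j + 1 : ℕ)) * ((n : ℝ) / 2 - (j + 1 : ℕ) + 1)) : ℝ) : ℂ) *
      (Real.sqrt (n.choose (j + 1)) : ℂ) = ((n - j : ℕ) : ℂ) * (Real.sqrt (n.choose j) : ℂ) := by
  have h1 : (n.choose (j + 1) : ℝ) * (j + 1 : ℕ) = n.choose j * (n - j : ℕ) := by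
    exact_mod_cast Nat.choose_succ_right_eq n j
  have h2 : ((n - j : ℕ) : ℝ) = n - j := by rw [Nat.cast_sub hj.le]
  have h3 : (0 : ℝ) ≤ ((n - j : ℕ) : ℝ) := Nat.cast_nonneg _
  rw [← Complex.ofReal_mul, ← Complex.ofReal_natCast (n - j), ← Complex.ofReal_mul]
  congr 1
  rw [← Real.sqrt_mul' _ (Nat.cast_nonneg _)]
  rw [show ((n : ℝ) / 2 * ((n : ℝ) / 2 + 1) -
      ((n : ℝ) / 2 - (j + 1 : ℕ)) * ((n : ℝ) / 2 - (j + 1 : ℕ) + 1)) * (n.choose (j + 1)) =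
      ((n - j : ℕ) : ℝ) ^ 2 * n.choose j by
    push_cast at h1 ⊢
    rw [h2] at h1 ⊢
    linear_combination ((n : ℝ) - j) * h1]
  rw [Real.sqrt_mul (sq_nonneg _), Real.sqrt_sq h3]

theorem sqrt_minus_eq (n j : ℕ) (hj : j < n) :
    ((Real.sqrt ((n : ℝ) / 2 * ((n : ℝ) / 2 + 1) -
      ((n : ℝ) / 2 - j) * ((n : ℝ) / 2 - j - 1)) : ℝ) : ℂ) *
      (Real.sqrt (n.choose j) : ℂ) = ((j + 1 : ℕ) : ℂ) * (Real.sqrt (n.choose (j + 1)) : ℂ) := by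
  have h1 : (n.choose (j + 1) : ℝ) * (j + 1 : ℕ) = n.choose j * (n - j : ℕ) := by
    exact_mod_cast Nat.choose_succ_right_eq n j
  have h2 : ((n - j : ℕ) : ℝ) = n - j := by rw [Nat.cast_sub hj.le]
  have h3 : (0 : ℝ) ≤ ((j + 1 : ℕ) : ℝ) := Nat.cast_nonneg _
  rw [← Complex.ofReal_mul, ← Complex.ofReal_natCast (j + 1), ← Complex.ofReal_mul]
  congr 1
  rw [← Real.sqrt_mul' _ (Nat.cast_nonneg _)]
  rw [show ((n : ℝ) / 2 * ((n : ℝ) / 2 + 1) -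
      ((n : ℝ) / 2 - j) * ((n : ℝ) / 2 - j - 1)) * (n.choose j) =
      ((j + 1 : ℕ) : ℝ) ^ 2 * n.choose (j + 1) by
    push_cast at h1 ⊢
    rw [h2] at h1
    linear_combination (-(j : ℝ) - 1) * h1]
  rw [Real.sqrt_mul (sq_nonneg _), Real.sqrt_sq h3]

theorem spinPlus_mulVec_spinorPow (n : ℕ) (z : Fin 2 → ℂ) (j : Fin (n + 1)) :
    (spinPlus n).mulVec (spinorPow n z) j = ((n - (j : ℕ) : ℕ) : ℂ) *
      (Real.sqrt (n.choose j) : ℂ) * z 0 ^ (n - (j : ℕ) - 1) * z 1 ^ ((j : ℕ) + 1) := by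
  by_cases hj : (j : ℕ) < n
  · have hlt : (j : ℕ) + 1 < n + 1 := by omega
    rw [Matrix.mulVec, dotProduct, Finset.sum_eq_single (⟨(j : ℕ) + 1, hlt⟩ : Fin (n + 1))]
    · rw [← sqrt_plus_eq n j hj]
      simp only [spinPlus, Matrix.of_apply, if_true, spinorPow, magnetic]
      rw [show n - ((j : ℕ) + 1) = n - (j : ℕ) - 1 by omega]
      ring
    · intro k _ hk
      have : ¬ ((j : ℕ) + 1 = k) := fun h => hk (Fin.ext h.symm)
      simp [spinPlus, this]
    · simp
  · have hn : n - (j : ℕ) = 0 := by omega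
    rw [hn, Matrix.mulVec, dotProduct]
    simp only [Nat.cast_zero, zero_mul]
    refine Finset.sum_eq_zero fun k _ => ?_
    have : ¬ ((j : ℕ) + 1 = k) := by have := k.2; omega
    simp [spinPlus, this]

theorem spinMinus_mulVec_spinorPow (n : ℕ) (z : Fin 2 → ℂ) (j : Fin (n + 1)) :
    (spinMinus n).mulVec (spinorPow n z) j = ((j : ℕ) : ℂ) *
      (Real.sqrt (n.choose j) : ℂ) * z 0 ^ (n - (j : ℕ) + 1) * z 1 ^ ((j : ℕ) - 1) := by
  obtain ⟨j, hj⟩ := j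
  cases j with
  | zero =>
    rw [Matrix.mulVec, dotProduct]
    simp only [Nat.cast_zero, zero_mul]
    refine Finset.sum_eq_zero fun k _ => ?_
    simp [spinMinus]
  | succ i =>
    have hlt : i < n + 1 := by omega
    have hi : i < n := by omega
    rw [Matrix.mulVec, dotProduct, Finset.sum_eq_single (⟨i, hlt⟩ : Fin (n + 1))]
    · simp only [spinMinus, Matrix.of_apply, if_true, spinorPow, magnetic]
      rw [← sqrt_minus_eq n i hi, show n - (i + 1) + 1 = n - i by omega,
        show i + 1 - 1 = i by omega]
      ring
    · intro k _ hk
      have : ¬ (i + 1 = (k : ℕ) + 1) := fun h => hk (Fin.ext (by simp; omega))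
      simp only [spinMinus, Matrix.of_apply, if_neg this, zero_mul]
    · simp

theorem dotPauli_eq (x : Fin 3 → ℝ) : dotPauli x =
    !![(x 2 : ℂ), x 0 - Complex.I * x 1; x 0 + Complex.I * x 1, -(x 2 : ℂ)] := by
  ext i j
  fin_cases i <;> fin_cases j <;>
    simp [dotPauli, pauli, Fin.sum_univ_three] <;> ring

/-- A curve through `1` with velocity `-(i / 2) x · σ` is mapped by `spinMatrix` to a curve with
velocity `-i x · s`: the spin operators are the Hermitean generators. -/
theorem spinMatrix_generator (n : ℕ) (x : Fin 3 → ℝ) (γ : ℝ → Matrix (Fin 2) (Fin 2) ℂ)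
    (h0 : γ 0 = 1)
    (hγ : ∀ i j, HasDerivAt (fun t => γ t i j) (((-Complex.I / 2) • dotPauli x) i j) 0) :
    ∀ i j, HasDerivAt (fun t => spinMatrix n (γ t) i j)
      (((-Complex.I) • dotSpin n x) i j) 0 := by
  have main : ∀ w : Fin (n + 1) → ℂ, ∀ j,
      HasDerivAt (fun t => (spinMatrix n (γ t)).mulVec w j)
        (((-Complex.I) • dotSpin n x).mulVec w j) 0 := by
    intro w
    have hw : w ∈ Submodule.span ℂ (Set.range (spinorPow n)) := by
      rw [span_spinorPow]; trivial
    induction hw using Submodule.span_induction with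
    | mem w hw =>
      obtain ⟨z, rfl⟩ := hw
      intro j
      simp only [spinMatrix_mulVec_spinorPow]
      have hz : ∀ i, HasDerivAt (fun t => (γ t).mulVec z i)
          (((-Complex.I / 2) • dotPauli x).mulVec z i) 0 := by
        intro i
        simp only [Matrix.mulVec, dotProduct, Fin.sum_univ_two]
        exact ((hγ i 0).mul_const _).add ((hγ i 1).mul_const _)
      have hp := ((((hz 0).pow (n - (j : ℕ))).const_mul
        (Real.sqrt (n.choose j) : ℂ)).mul ((hz 1).pow (j : ℕ)))
      refine HasDerivAt.congr_deriv (f := fun t => spinorPow n ((γ t).mulVec z) j) hp ?_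
      simp only [Pi.pow_apply, h0, Matrix.one_mulVec]
      have hS : ((-Complex.I) • dotSpin n x).mulVec (spinorPow n z) j =
          (-Complex.I) * ((x 0 : ℂ) * (1 / 2 * ((spinPlus n).mulVec (spinorPow n z) j +
            (spinMinus n).mulVec (spinorPow n z) j)) +
          (x 1 : ℂ) * (-Complex.I / 2 * ((spinPlus n).mulVec (spinorPow n z) j -
            (spinMinus n).mulVec (spinorPow n z) j)) +
          (x 2 : ℂ) * (((n : ℂ) / 2 - (j : ℕ)) * spinorPow n z j)) := by
        simp only [dotSpin, spinOp, Fin.sum_univ_three, Matrix.smul_mulVec, Matrix.add_mulVec,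
          Matrix.sub_mulVec, Pi.smul_apply, Pi.add_apply, Pi.sub_apply, smul_eq_mul,
          Matrix.cons_val_zero, Matrix.cons_val_one, Matrix.cons_val, Matrix.mulVec_diagonal,
          magnetic]
        push_cast
        ring
      rw [hS, spinPlus_mulVec_spinorPow, spinMinus_mulVec_spinorPow, dotPauli_eq]
      have hjn : (j : ℕ) ≤ n := Nat.lt_succ_iff.mp j.2
      obtain ⟨m, hm⟩ := Nat.exists_eq_add_of_le hjn
      have hm' : n - (j : ℕ) = m := by omega
      have hnc : (n : ℂ) = (j : ℕ) + m := by rw [← Nat.cast_add, ← hm]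
      simp only [spinorPow, hm', hnc]
      generalize (Real.sqrt (n.choose j) : ℂ) = c
      generalize (j : ℕ) = k
      have hI := Complex.I_mul_I
      simp only [Matrix.mulVec, dotProduct, Fin.sum_univ_two, Matrix.smul_apply,
        Matrix.of_apply, Matrix.cons_val', Matrix.cons_val_zero, Matrix.cons_val_one,
        smul_eq_mul]
      cases m with
      | zero =>
        cases k with
        | zero => simp
        | succ k => simp; ring
      | succ m =>
        cases k with
        | zero => simp; ring
        | succ k => simp; ring
    | zero => intro j; simp only [Matrix.mulVec_zero, Pi.zero_apply]; exact hasDerivAt_const _ _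
    | add u v _ _ hu hv =>
      intro j
      simp only [Matrix.mulVec_add, Pi.add_apply]
      exact (hu j).add (hv j)
    | smul c u _ hu =>
      intro j
      simp only [Matrix.mulVec_smul, Pi.smul_apply]
      exact (hu j).const_smul c
  intro i j
  simpa [Matrix.mulVec_single_one] using main (Pi.single j 1) i

/-- The matrix of the rotation induced by `g`: `(R_g)ᵢⱼ = tr (σᵢ g σⱼ g*) / 2`. -/
def rotationMatrix (g : Matrix (Fin 2) (Fin 2) ℂ) : Matrix (Fin 3) (Fin 3) ℝ :=
  Matrix.of fun i j => ((pauli i * g * pauli j * g.conjTranspose).trace / 2).re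

theorem SU2.entries (g : SU2) : g.1 0 1 = -star (g.1 1 0) ∧ g.1 1 1 = star (g.1 0 0) ∧
    (g.1 0 0).re ^ 2 + (g.1 0 0).im ^ 2 + (g.1 1 0).re ^ 2 + (g.1 1 0).im ^ 2 = 1 := by
  obtain ⟨hu, hd⟩ := Matrix.mem_specialUnitaryGroup_iff.mp g.2
  have h1 : star g.1 = g.1.adjugate := by
    have hu' := Matrix.mem_unitaryGroup_iff'.mp hu
    calc star g.1 = star g.1 * (g.1 * g.1.adjugate) := by rw [Matrix.mul_adjugate, hd]; simp
      _ = g.1.adjugate := by rw [← mul_assoc, hu', one_mul]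
  have h00 := congrFun (congrFun h1 0) 0
  have h01 := congrFun (congrFun h1 0) 1
  simp only [Matrix.star_apply, Matrix.adjugate_fin_two, Matrix.of_apply, Matrix.cons_val',
    Matrix.cons_val_zero, Matrix.cons_val_one] at h00 h01
  have e01 : g.1 0 1 = -star (g.1 1 0) := by rw [h01, neg_neg]
  refine ⟨e01, h00.symm, ?_⟩
  rw [Matrix.det_fin_two, e01, ← h00] at hd
  have := congrArg Complex.re hd
  simp at this
  linarith

theorem rotationMatrix_eq (g : SU2) (p q r t : ℝ) (h0 : g.1 0 0 = ⟨p, q⟩) (h1 : g.1 1 0 = ⟨r, t⟩) :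
    rotationMatrix g.1 =
      !![p ^ 2 - q ^ 2 - r ^ 2 + t ^ 2, 2 * (p * q - r * t), 2 * (p * r + q * t);
        -2 * (p * q + r * t), p ^ 2 - q ^ 2 + r ^ 2 - t ^ 2, 2 * (p * t - q * r);
        -2 * (p * r - q * t), -2 * (p * t + q * r), p ^ 2 + q ^ 2 - r ^ 2 - t ^ 2] := by
  obtain ⟨e1, e2, -⟩ := g.entries
  ext i j
  fin_cases i <;> fin_cases j <;>
    simp [rotationMatrix, pauli, Matrix.trace, Matrix.mul_apply, Fin.sum_univ_two, e1, e2, h0, h1]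
    <;> ring

theorem rotationMatrix_mem (g : SU2) :
    rotationMatrix g.1 ∈ Matrix.specialOrthogonalGroup (Fin 3) ℝ := by
  obtain ⟨-, -, h⟩ := g.entries
  have hR := rotationMatrix_eq g _ _ _ _ rfl rfl
  set p := (g.1 0 0).re
  set q := (g.1 0 0).im
  set r := (g.1 1 0).re
  set t := (g.1 1 0).im
  have h2 : (p ^ 2 + q ^ 2 + r ^ 2 + t ^ 2) ^ 2 = 1 := by rw [h]; norm_num
  have h3 : (p ^ 2 + q ^ 2 + r ^ 2 + t ^ 2) ^ 3 = 1 := by rw [h]; norm_num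
  rw [hR, Matrix.mem_specialOrthogonalGroup_iff, Matrix.mem_orthogonalGroup_iff']
  constructor
  · ext i j
    fin_cases i <;> fin_cases j <;>
      simp [Matrix.mul_apply, Fin.sum_univ_three] <;>
      first
      | ring1
      | linear_combination h2
  · rw [Matrix.det_fin_three]
    simp
    linear_combination h3

/-- The rotation `R_g ∈ SO(3)` induced by `g ∈ SU(2)`. -/
def inducedRotation (g : SU2) : SO3 := ⟨rotationMatrix g.1, rotationMatrix_mem g⟩

theorem pauli_conj (g : SU2) (x : Fin 3 → ℝ) :
    g.1 * dotPauli x * g.1.conjTranspose = dotPauli ((inducedRotation g).1.mulVec x) := by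
  have hR : (inducedRotation g).1 = _ := rotationMatrix_eq g _ _ _ _ rfl rfl
  obtain ⟨e1, e2, -⟩ := g.entries
  rw [hR, dotPauli_eq, dotPauli_eq]
  have ha := (Complex.re_add_im (g.1 0 0)).symm
  have hb := (Complex.re_add_im (g.1 1 0)).symm
  ext i j
  fin_cases i <;> fin_cases j <;>
    apply Complex.ext <;>
    simp [Matrix.mul_apply, Fin.sum_univ_two, Fin.sum_univ_three, e1, e2, Matrix.mulVec,
      dotProduct, pow_two] <;> ring

/-- The defining relation `U_g (x · s) U_g* = (R_g x) · s` of the rotation `R_g`. -/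
theorem spinMatrix_conj (n : ℕ) (g : SU2) (x : Fin 3 → ℝ) :
    spinMatrix n g.1 * dotSpin n x * (spinMatrix n g.1).conjTranspose =
      dotSpin n ((inducedRotation g).1.mulVec x) := by
  have hu : g.1 * g.1.conjTranspose = 1 :=
    Matrix.mem_unitaryGroup_iff.mp (Matrix.mem_specialUnitaryGroup_iff.mp g.2).1
  have lin : ∀ (Y : Matrix (Fin 2) (Fin 2) ℂ) (i j : Fin 2),
      HasDerivAt (fun t : ℝ => (1 + (t : ℂ) • Y) i j) (Y i j) 0 := by
    intro Y i j
    simp only [Matrix.add_apply, Matrix.smul_apply, smul_eq_mul]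
    have := ((Complex.ofRealCLM.hasDerivAt (x := (0 : ℝ))).mul_const (Y i j)).const_add
      ((1 : Matrix (Fin 2) (Fin 2) ℂ) i j)
    simpa using this
  have d1 := spinMatrix_generator n x _ (by simp) (lin ((-Complex.I / 2) • dotPauli x))
  have d2 := spinMatrix_generator n ((inducedRotation g).1.mulVec x) _ (by simp)
    (lin ((-Complex.I / 2) • dotPauli ((inducedRotation g).1.mulVec x)))
  have hcurve : ∀ t : ℝ, spinMatrix n
      (1 + (t : ℂ) • ((-Complex.I / 2) • dotPauli ((inducedRotation g).1.mulVec x))) =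
      spinMatrix n g.1 * spinMatrix n (1 + (t : ℂ) • ((-Complex.I / 2) • dotPauli x)) *
        (spinMatrix n g.1).conjTranspose := by
    intro t
    rw [← spinMatrix_conjTranspose, ← spinMatrix_mul, ← spinMatrix_mul, ← pauli_conj]
    congr 1
    simp only [mul_add, add_mul, mul_one, hu, Matrix.mul_smul, Matrix.smul_mul]
  have key : spinMatrix n g.1 * ((-Complex.I) • dotSpin n x) * (spinMatrix n g.1).conjTranspose =
      (-Complex.I) • dotSpin n ((inducedRotation g).1.mulVec x) := by
    ext i j
    refine HasDerivAt.unique ?_ (d2 i j)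
    simp only [hcurve, Matrix.mul_apply (M := _ * _), Matrix.mul_apply (M := spinMatrix n g.1)]
    exact HasDerivAt.fun_sum fun k _ =>
      (HasDerivAt.fun_sum fun l _ => (d1 l k).const_mul _).mul_const _
  rw [Matrix.mul_smul, Matrix.smul_mul] at key
  exact smul_right_injective _ (neg_ne_zero.mpr Complex.I_ne_zero) key

/-! ### Systems of `N` spins -/

/-- The Hilbert space of `N` spins, the `N`-fold tensor power of `ℂ ^ (n + 1)`, in coordinates with
respect to the orthonormal basis of the product vectors `|m₁, …, m_N⟩`. -/
abbrev HilbertN (n N : ℕ) : Type := EuclideanSpace ℂ (Fin N → Fin (n + 1))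

/-- The matrix of `A ⊗ ⋯ ⊗ A` (`N` factors) in the product basis. -/
def tensorPow {ι : Type} (N : ℕ) (A : Matrix ι ι ℂ) : Matrix (Fin N → ι) (Fin N → ι) ℂ :=
  Matrix.of fun m m' => ∏ μ, A (m μ) (m' μ)

theorem tensorPow_mul {ι : Type} [Fintype ι] [DecidableEq ι] (N : ℕ) (A B : Matrix ι ι ℂ) :
    tensorPow N (A * B) = tensorPow N A * tensorPow N B := by
  ext m m'
  simp only [tensorPow, Matrix.of_apply, Matrix.mul_apply, ← Finset.prod_mul_distrib]
  rw [Finset.prod_univ_sum, Fintype.piFinset_univ]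

theorem tensorPow_one {ι : Type} [DecidableEq ι] (N : ℕ) :
    tensorPow N (1 : Matrix ι ι ℂ) = 1 := by
  ext m m'
  simp only [tensorPow, Matrix.of_apply, Matrix.one_apply]
  split_ifs with h
  · subst h; simp
  · obtain ⟨μ, hμ⟩ := Function.ne_iff.mp h
    exact Finset.prod_eq_zero (Finset.mem_univ μ) (if_neg hμ)

theorem tensorPow_star {ι : Type} (N : ℕ) (A : Matrix ι ι ℂ) :
    tensorPow N (star A) = star (tensorPow N A) := by
  ext m m'
  simp [tensorPow, Matrix.star_apply]

theorem toEuclideanCLM_tensorPow_mem_unitary (n N : ℕ) (g : SU2) :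
    Matrix.toEuclideanCLM (𝕜 := ℂ) (tensorPow N (spinMatrix n g.1)) ∈
      unitary (HilbertN n N →L[ℂ] HilbertN n N) := by
  have hu := (Matrix.mem_specialUnitaryGroup_iff.mp g.2).1
  have h1 := Matrix.mem_unitaryGroup_iff'.mp hu
  have h2 := Matrix.mem_unitaryGroup_iff.mp hu
  have hs : star (spinMatrix n g.1) = spinMatrix n (star g.1) :=
    (spinMatrix_conjTranspose n g.1).symm
  refine Unitary.mem_iff.mpr ⟨?_, ?_⟩ <;>
    rw [← map_star, ← map_mul, ← tensorPow_star, ← tensorPow_mul, hs, ← spinMatrix_mul]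
  · rw [h1, spinMatrix_one, tensorPow_one, map_one]
  · rw [h2, spinMatrix_one, tensorPow_one, map_one]

/-- The unitary representation `g ↦ U_g ⊗ ⋯ ⊗ U_g` of `SU(2)` on the Hilbert space of `N` spins,
where `g ↦ U_g` is the irreducible representation with spin `s = n / 2`. -/
def spinRep (n N : ℕ) : SU2 →* unitary (HilbertN n N →L[ℂ] HilbertN n N) where
  toFun g := ⟨Matrix.toEuclideanCLM (𝕜 := ℂ) (tensorPow N (spinMatrix n g.1)),
    toEuclideanCLM_tensorPow_mem_unitary n N g⟩
  map_one' := Subtype.ext <| by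
    change Matrix.toEuclideanCLM (𝕜 := ℂ) (tensorPow N (spinMatrix n 1)) = 1
    rw [spinMatrix_one, tensorPow_one, map_one]
  map_mul' g h := Subtype.ext <| by
    change Matrix.toEuclideanCLM (𝕜 := ℂ) (tensorPow N (spinMatrix n (g.1 * h.1))) = _ * _
    rw [spinMatrix_mul, tensorPow_mul, map_mul]

/-- The unit sphere of `ℝ³`. -/
abbrev Sphere2 : Type := Metric.sphere (0 : EuclideanSpace ℝ (Fin 3)) 1

/-- The classical phase space of `N` spins, the `N`-fold product of unit spheres. -/
abbrev PhaseSpace (N : ℕ) : Type := Fin N → Sphere2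

theorem norm_toLp_mulVec (R : SO3) (v : EuclideanSpace ℝ (Fin 3)) :
    ‖WithLp.toLp 2 (R.1.mulVec v.ofLp)‖ = ‖v‖ := by
  rw [← sq_eq_sq₀ (norm_nonneg _) (norm_nonneg _), EuclideanSpace.real_norm_sq_eq,
    EuclideanSpace.real_norm_sq_eq]
  have h : ∀ w : Fin 3 → ℝ, ∑ i, w i ^ 2 = w ⬝ᵥ w := fun w => by simp [dotProduct, sq]
  rw [h, h, Matrix.dotProduct_mulVec, ← Matrix.mulVec_transpose, Matrix.mulVec_mulVec]
  have hR' : R.1.transpose * R.1 = 1 := by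
    have h1 := (Matrix.mem_specialOrthogonalGroup_iff.mp R.2).1
    rw [Matrix.mem_orthogonalGroup_iff'] at h1
    exact h1
  rw [hR', Matrix.one_mulVec]

/-- The action of a rotation on the unit sphere. -/
def rotateSphere (R : SO3) (Ω : Sphere2) : Sphere2 :=
  ⟨WithLp.toLp 2 (R.1.mulVec Ω.1.ofLp), by
    rw [mem_sphere_zero_iff_norm, norm_toLp_mulVec]; exact mem_sphere_zero_iff_norm.mp Ω.2⟩

/-- The simultaneous action of a rotation on all factors of the phase space. -/
def rotate (N : ℕ) (R : SO3) (Ω : PhaseSpace N) : PhaseSpace N := fun μ => rotateSphere R (Ω μ)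

/-- The polar angle `θ ∈ [0, π]` of a unit vector. -/
def polar (Ω : Sphere2) : ℝ := Real.arccos (Ω.1 2)

/-- The azimuthal angle of a unit vector; at the two poles, where it is not determined, it is
set to `0`. -/
def azimuth (Ω : Sphere2) : ℝ := Complex.arg (⟨Ω.1 0, Ω.1 1⟩ : ℂ)

/-- The coherent state `|Ω⟩` of a single spin.  The component with index `k`, that is with `m = s - k`,
is `(2s choose s + m) ^ (1/2) (cos (θ/2)) ^ (s + m) (sin (θ/2)) ^ (s - m) e ^ (i (s - m) φ)`. -/
def coherent (n : ℕ) (Ω : Sphere2) : Fin (n + 1) → ℂ := fun k =>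
  (Real.sqrt (n.choose (n - (k : ℕ))) : ℂ) * (Real.cos (polar Ω / 2) : ℂ) ^ (n - (k : ℕ)) *
    (Real.sin (polar Ω / 2) : ℂ) ^ (k : ℕ) *
    Complex.exp (Complex.I * (k : ℕ) * azimuth Ω)

/-- The coherent state `|Ω⟩ = |Ω₁⟩ ⊗ ⋯ ⊗ |Ω_N⟩` of `N` spins. -/
def coherentN (n N : ℕ) (Ω : PhaseSpace N) : HilbertN n N :=
  WithLp.toLp 2 fun m => ∏ μ, coherent n (Ω μ) (m μ)

/-- The measure `((2s + 1) / 4π) ^ N dΩ₁ ⋯ dΩ_N` on the phase space, where `dΩ` is the surface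
measure of the unit sphere (of total mass `4π`). -/
def phaseMeasure (n N : ℕ) : Measure (PhaseSpace N) :=
  ENNReal.ofReal ((((n : ℝ) + 1) / (4 * Real.pi)) ^ N) •
    Measure.pi fun _ => (volume : Measure (EuclideanSpace ℝ (Fin 3))).toSphere

instance (n N : ℕ) : IsFiniteMeasure (phaseMeasure n N) := by
  unfold phaseMeasure
  exact Measure.smul_finite _ ENNReal.ofReal_ne_top

theorem measurable_coherent (n : ℕ) (k : Fin (n + 1)) : Measurable fun Ω => coherent n Ω k := by
  have h : ∀ i, Measurable fun Ω : Sphere2 => Ω.1 i := fun i => by fun_prop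
  have hp : Measurable polar := Real.measurable_arccos.comp (h 2)
  have ha : Measurable azimuth := by
    refine Complex.measurable_arg.comp ?_
    have : (fun Ω : Sphere2 => (⟨Ω.1 0, Ω.1 1⟩ : ℂ)) =
        fun Ω => Complex.equivRealProdCLM.symm (Ω.1 0, Ω.1 1) := rfl
    rw [this]
    exact Complex.equivRealProdCLM.symm.continuous.measurable.comp ((h 0).prodMk (h 1))
  unfold coherent
  fun_prop

theorem norm_coherent_le (n : ℕ) (Ω : Sphere2) (k : Fin (n + 1)) :
    ‖coherent n Ω k‖ ≤ Real.sqrt (n.choose (n - (k : ℕ))) := by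
  have h1 : ‖(Real.sqrt (n.choose (n - (k : ℕ))) : ℂ)‖ = Real.sqrt (n.choose (n - (k : ℕ))) := by
    rw [Complex.norm_real, Real.norm_of_nonneg (Real.sqrt_nonneg _)]
  have h2 : ‖(Real.cos (polar Ω / 2) : ℂ)‖ ≤ 1 := by
    rw [Complex.norm_real]; exact Real.abs_cos_le_one _
  have h3 : ‖(Real.sin (polar Ω / 2) : ℂ)‖ ≤ 1 := by
    rw [Complex.norm_real]; exact Real.abs_sin_le_one _
  have h4 : ‖Complex.exp (Complex.I * (k : ℕ) * azimuth Ω)‖ = 1 := by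
    have := Complex.norm_exp_ofReal_mul_I ((k : ℕ) * azimuth Ω)
    rw [← this]; push_cast; ring_nf
  rw [coherent, norm_mul, norm_mul, norm_mul, h1, h4, norm_pow, norm_pow, mul_one, mul_assoc]
  exact mul_le_of_le_one_right (Real.sqrt_nonneg _)
    (mul_le_one₀ (pow_le_one₀ (norm_nonneg _) h2) (by positivity) (pow_le_one₀ (norm_nonneg _) h3))

theorem memLp_inner_coherentN (n N : ℕ) (φ : HilbertN n N) :
    MemLp (fun Ω => inner ℂ (coherentN n N Ω) φ) 2 (phaseMeasure n N) := by
  simp only [PiLp.inner_apply, RCLike.inner_apply]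
  refine memLp_finsetSum _ fun m _ => MemLp.const_mul ?_ _
  refine MemLp.of_bound (C := ∏ μ, Real.sqrt (n.choose (n - (m μ : ℕ)))) ?_ ?_
  · refine Measurable.aestronglyMeasurable ?_
    refine Complex.continuous_conj.measurable.comp ?_
    change Measurable fun Ω : PhaseSpace N => ∏ μ, coherent n (Ω μ) (m μ)
    refine Finset.measurable_prod _ fun μ _ => ?_
    exact (measurable_coherent n (m μ)).comp (measurable_pi_apply μ)
  · refine Filter.Eventually.of_forall fun Ω => ?_
    rw [RCLike.norm_conj]
    change ‖∏ μ, coherent n (Ω μ) (m μ)‖ ≤ _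
    rw [norm_prod]
    exact Finset.prod_le_prod (fun _ _ => norm_nonneg _) fun μ _ => norm_coherent_le n _ _

/-- The map `j : 𝓗 → L²`, `j(φ)(Ω) = ⟨Ω|φ⟩`. -/
def coherentTransform (n N : ℕ) : HilbertN n N →L[ℂ] Lp ℂ 2 (phaseMeasure n N) :=
  LinearMap.toContinuousLinearMap
    { toFun := fun φ => (memLp_inner_coherentN n N φ).toLp _
      map_add' := fun φ ψ => by
        rw [← MemLp.toLp_add]
        congr 1
        funext Ω
        exact inner_add_right _ _ _
      map_smul' := fun c φ => by
        rw [RingHom.id_apply, ← MemLp.toLp_const_smul]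
        congr 1
        funext Ω
        exact inner_smul_right _ _ _ }

/-- The operator `F̂` on `L²` of multiplication by an essentially bounded function `F`. -/
def multiplication (n N : ℕ) (F : Lp ℂ ∞ (phaseMeasure n N)) :
    Lp ℂ 2 (phaseMeasure n N) →L[ℂ] Lp ℂ 2 (phaseMeasure n N) :=
  (ContinuousLinearMap.mul ℂ ℂ).holderL (phaseMeasure n N) ∞ 2 2 F

theorem coeFn_multiplication (n N : ℕ) (F : Lp ℂ ∞ (phaseMeasure n N))
    (G : Lp ℂ 2 (phaseMeasure n N)) :
    multiplication n N F G =ᵐ[phaseMeasure n N] fun Ω => F Ω * G Ω :=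
  ContinuousLinearMap.coeFn_holder _ F G

/-- The contravariant matrix `A(F) = j* F̂ j` of an essentially bounded function `F`. -/
def contravariantMatrix (n N : ℕ) (F : Lp ℂ ∞ (phaseMeasure n N)) :
    HilbertN n N →L[ℂ] HilbertN n N :=
  (coherentTransform n N).adjoint ∘L multiplication n N F ∘L coherentTransform n N

end SpinCoherent

end

open SpinCoherent

namespace SpinCoherent

/-! Weakly, $A(F)=\int F(\Omega)\,|\Omega\rangle\langle\Omega|\,\tilde d\Omega$
(`inner_contravariantMatrix`). Conjugation by $U_g$ acts only on the projections, so two facts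
suffice: $U_g|\Omega\rangle\langle\Omega|U_g^*=|R_g\Omega\rangle\langle R_g\Omega|$, and $\tilde
d\Omega$ is invariant under $R_g$. The substitution $\Omega\mapsto R_g\Omega$ then gives the
formula.

For the first fact, `exists_phase_spinRep_coherentN` shows that $U_g|\Omega\rangle$ is a phase times
$|R_g\Omega\rangle$. A one-spin coherent state is the $2s$-th power of a spinor $z$ with
$zz^*=\frac12(1+\Omega\cdot\sigma)$. Conjugating by $g$ turns $\Omega$ into $R_g\Omega$
(`pauli_conj`), and a unit vector is determined by its projection up to a phase. Powers and tensor
products carry this over to any $s$ and $N$.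

For the second fact, the surface measure of a set is, up to a constant, the Lebesgue measure of the
cone over it, and rotations preserve Lebesgue measure (`measurePreserving_rotateSphere`). -/

/-! ### Coherent states as powers of spinors -/

/-- The spinor `(cos (θ/2), sin (θ/2) e ^ (i φ))` of a point of the sphere. -/
noncomputable def spinor (Ω : Sphere2) : Fin 2 → ℂ :=
  ![(Real.cos (polar Ω / 2) : ℂ), (Real.sin (polar Ω / 2) : ℂ) * Complex.exp (Complex.I * azimuth Ω)]

/-- The phase $e^{ik\varphi}$ is the $k$-th power of the phase in the second spinor component, and
the binomials agree by symmetry. This makes `spinMatrix_mulVec_spinorPow` available for coherent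
states. -/
theorem coherent_eq_spinorPow (n : ℕ) (Ω : Sphere2) : coherent n Ω = spinorPow n (spinor Ω) := by
  funext k
  have hk : (k : ℕ) ≤ n := Nat.lt_succ_iff.mp k.2
  simp only [coherent, spinorPow, spinor, Matrix.cons_val_zero, Matrix.cons_val_one,
    Nat.choose_symm hk, mul_pow, ← Complex.exp_nat_mul]
  rw [show Complex.I * (k : ℕ) * azimuth Ω = (k : ℕ) * (Complex.I * azimuth Ω) by ring]
  ring

theorem sphere_sq_add_sq (Ω : Sphere2) : Ω.1 0 ^ 2 + Ω.1 1 ^ 2 + Ω.1 2 ^ 2 = 1 := by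
  have h := EuclideanSpace.real_norm_sq_eq Ω.1
  rw [mem_sphere_zero_iff_norm.mp Ω.2, Fin.sum_univ_three] at h
  linarith

theorem cos_polar (Ω : Sphere2) : Real.cos (polar Ω) = Ω.1 2 := by
  have h := sphere_sq_add_sq Ω
  -- `Real.arccos` inverts the cosine only on $[-1,1]$; both bounds follow from the equation of the
  -- sphere.
  exact Real.cos_arccos (by nlinarith [sq_nonneg (Ω.1 0), sq_nonneg (Ω.1 1)])
    (by nlinarith [sq_nonneg (Ω.1 0), sq_nonneg (Ω.1 1)])

theorem sin_polar_mul_exp_azimuth (Ω : Sphere2) :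
    (Real.sin (polar Ω) : ℂ) * Complex.exp (Complex.I * azimuth Ω) =
      Ω.1 0 + Complex.I * Ω.1 1 := by
  have h : Real.sin (polar Ω) = ‖(⟨Ω.1 0, Ω.1 1⟩ : ℂ)‖ := by
    rw [polar, Real.sin_arccos, Complex.norm_def, Complex.normSq_mk]
    congr 1
    linarith [sphere_sq_add_sq Ω]
  -- The polar form also holds for the number $0$, so the poles need no separate case.
  rw [h, mul_comm Complex.I, azimuth, Complex.norm_mul_exp_arg_mul_I]
  apply Complex.ext <;> simp

/-- The projection onto a spinor is `(1 + Ω · σ) / 2`. -/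
theorem vecMulVec_spinor (Ω : Sphere2) :
    Matrix.vecMulVec (spinor Ω) (star (spinor Ω)) =
      (1 / 2 : ℂ) • (1 + dotPauli Ω.1.ofLp) := by
  have hc : 2 * Real.cos (polar Ω / 2) ^ 2 = 1 + Ω.1 2 := by
    rw [Real.cos_sq, show 2 * (polar Ω / 2) = polar Ω by ring, cos_polar]; ring
  have hs : 2 * Real.sin (polar Ω / 2) ^ 2 = 1 - Ω.1 2 := by
    rw [Real.sin_sq]; linarith
  have hsc : Real.sin (polar Ω) = 2 * Real.sin (polar Ω / 2) * Real.cos (polar Ω / 2) := by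
    rw [← Real.sin_two_mul]; congr 1; ring
  have he := sin_polar_mul_exp_azimuth Ω
  have he' := congrArg (starRingEnd ℂ) he
  -- Needed only for the lower right entry, where the phase meets its own conjugate.
  have hn : Complex.exp (Complex.I * azimuth Ω) *
      starRingEnd ℂ (Complex.exp (Complex.I * azimuth Ω)) = 1 := by
    rw [Complex.mul_conj, Complex.normSq_eq_norm_sq, mul_comm, Complex.norm_exp_ofReal_mul_I]
    simp
  have hc' : (2 : ℂ) * (Real.cos (polar Ω / 2) : ℂ) ^ 2 = 1 + (Ω.1 2 : ℂ) := by
    simpa only [Complex.ofReal_mul, Complex.ofReal_pow, Complex.ofReal_add, Complex.ofReal_one,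
      Complex.ofReal_ofNat] using congrArg Complex.ofReal hc
  have hs' : (2 : ℂ) * (Real.sin (polar Ω / 2) : ℂ) ^ 2 = 1 - (Ω.1 2 : ℂ) := by
    simpa only [Complex.ofReal_mul, Complex.ofReal_pow, Complex.ofReal_sub, Complex.ofReal_one,
      Complex.ofReal_ofNat] using congrArg Complex.ofReal hs
  simp only [map_mul, map_add, Complex.conj_ofReal, Complex.conj_I] at he'
  rw [hsc] at he he'
  push_cast only [Complex.ofReal_mul, Complex.ofReal_ofNat] at he he'
  rw [dotPauli_eq]
  have hst : ∀ z : ℂ, star z = starRingEnd ℂ z := fun _ => rfl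
  ext i j
  fin_cases i <;> fin_cases j <;>
    simp only [Matrix.vecMulVec_apply, spinor, Pi.star_apply, hst, Matrix.smul_apply, Matrix.add_apply,
      Matrix.one_apply, Matrix.of_apply, Matrix.cons_val', Matrix.cons_val_zero,
      Matrix.cons_val_one, Fin.zero_eta, Fin.mk_one, map_mul, Complex.conj_ofReal, smul_eq_mul,
      if_true, Fin.isValue, zero_ne_one, one_ne_zero, if_false, Matrix.cons_val_fin_one]
  · linear_combination hc' / 2
  · linear_combination he' / 2
  · linear_combination he / 2
  · linear_combination hs' / 2 + (Real.sin (polar Ω / 2) : ℂ) ^ 2 * hn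

theorem star_spinor_dotProduct (Ω : Sphere2) : star (spinor Ω) ⬝ᵥ spinor Ω = 1 := by
  have h := congrArg Matrix.trace (vecMulVec_spinor Ω)
  rw [Matrix.trace_vecMulVec, dotProduct_comm] at h
  rw [h, dotPauli_eq, Matrix.trace_fin_two]
  simp
  ring

/-! ### Covariance of coherent states up to a phase -/

/-- Vectors with the same rank-one projection differ by a phase. -/
theorem exists_phase_of_vecMulVec_eq {ι : Type*} [Fintype ι] {v w : ι → ℂ}
    (hw : star w ⬝ᵥ w = 1)
    (h : Matrix.vecMulVec v (star v) = Matrix.vecMulVec w (star w)) :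
    ∃ c : ℂ, star c * c = 1 ∧ v = c • w := by
  -- Both projections are applied to the unit vector $w$.
  have h1 : (star v ⬝ᵥ w) • v = w := by
    have := congrArg (fun A => A.mulVec w) h
    simpa [Matrix.vecMulVec_mulVec, hw] using this
  have h2 : star (star v ⬝ᵥ w) = star w ⬝ᵥ v := by
    rw [Matrix.star_dotProduct, star_star, dotProduct_comm]
  have h3 : star (star w ⬝ᵥ v) * (star w ⬝ᵥ v) = 1 := by
    rw [← h2, star_star]
    -- Both copies of $w$ in $1=\langle w,w\rangle$ become $\langle v,w\rangle v$. Pulling the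
    -- scalar out of the second and folding the first back leaves $\langle v,w\rangle\langle
    -- w,v\rangle$.
    conv_rhs => rw [← hw, ← h1]
    rw [dotProduct_smul, h1, h2, smul_eq_mul]
  refine ⟨star w ⬝ᵥ v, h3, ?_⟩
  have h4 : (star w ⬝ᵥ v) * (star v ⬝ᵥ w) = 1 := by rw [← h3, ← h2, star_star, mul_comm]
  calc v = ((star w ⬝ᵥ v) * (star v ⬝ᵥ w)) • v := by rw [h4, one_smul]
    _ = (star w ⬝ᵥ v) • w := by rw [← smul_smul, h1]

/-- The projection onto $gz$ is
$g\,\frac12(1+\Omega\cdot\sigma)\,g^*=\frac12(1+R_g\Omega\cdot\sigma)$, which is also the projection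
onto the spinor of $R_g\Omega$. The phase $c$ absorbs the convention that the first component of a
spinor is real. -/
theorem exists_phase_mulVec_spinor (g : SU2) (Ω : Sphere2) :
    ∃ c : ℂ, star c * c = 1 ∧
      g.1.mulVec (spinor Ω) = c • spinor (rotateSphere (inducedRotation g) Ω) := by
  refine exists_phase_of_vecMulVec_eq (star_spinor_dotProduct _) ?_
  have hu : g.1 * g.1.conjTranspose = 1 :=
    Matrix.mem_unitaryGroup_iff.mp (Matrix.mem_specialUnitaryGroup_iff.mp g.2).1
  rw [vecMulVec_spinor, Matrix.star_mulVec, ← Matrix.mul_vecMulVec, ← Matrix.vecMulVec_mul,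
    vecMulVec_spinor, rotateSphere, ← pauli_conj]
  simp only [Matrix.mul_smul, Matrix.smul_mul, mul_add, add_mul, one_mul, hu, mul_assoc]

theorem spinorPow_smul (n : ℕ) (c : ℂ) (z : Fin 2 → ℂ) :
    spinorPow n (c • z) = c ^ n • spinorPow n z := by
  funext j
  have hj : n = n - (j : ℕ) + j := (Nat.sub_add_cancel (Nat.lt_succ_iff.mp j.2)).symm
  have hc : c ^ n = c ^ (n - (j : ℕ)) * c ^ (j : ℕ) := by rw [← pow_add, ← hj]
  simp only [spinorPow, Pi.smul_apply, smul_eq_mul, mul_pow, hc]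
  ring

/-- The $n$-th power map is equivariant and homogeneous of degree $n$, so the spinor phase $c$
becomes $c^n$. -/
theorem exists_phase_mulVec_coherent (n : ℕ) (g : SU2) (Ω : Sphere2) :
    ∃ c : ℂ, star c * c = 1 ∧ (spinMatrix n g.1).mulVec (coherent n Ω) =
      c • coherent n (rotateSphere (inducedRotation g) Ω) := by
  obtain ⟨c, hc, h⟩ := exists_phase_mulVec_spinor g Ω
  refine ⟨c ^ n, by rw [star_pow, ← mul_pow, hc, one_pow], ?_⟩
  rw [coherent_eq_spinorPow, coherent_eq_spinorPow, spinMatrix_mulVec_spinorPow, h, spinorPow_smul]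

/-- Distributivity: a product over sites of sums over one index is a sum over multi-indices of
products. -/
theorem tensorPow_mulVec_prod {ι : Type} [Fintype ι] [DecidableEq ι] (N : ℕ) (A : Matrix ι ι ℂ)
    (v : Fin N → ι → ℂ) :
    (tensorPow N A).mulVec (fun m => ∏ μ, v μ (m μ)) = fun m => ∏ μ, A.mulVec (v μ) (m μ) := by
  funext m
  simp only [Matrix.mulVec, dotProduct, tensorPow, Matrix.of_apply, ← Finset.prod_mul_distrib]
  rw [Finset.prod_univ_sum, Fintype.piFinset_univ]

/-- Up to a phase, `U_g |Ω⟩ = |R_g Ω⟩`. -/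
theorem exists_phase_spinRep_coherentN (n N : ℕ) (g : SU2) (Ω : PhaseSpace N) :
    ∃ c : ℂ, star c * c = 1 ∧ (spinRep n N g).1 (coherentN n N Ω) =
      c • coherentN n N (rotate N (inducedRotation g) Ω) := by
  -- Each site has its own phase; the total phase is their product.
  choose c hc h using fun μ => exists_phase_mulVec_coherent n g (Ω μ)
  refine ⟨∏ μ, c μ, by
    rw [star_prod, ← Finset.prod_mul_distrib, Finset.prod_congr rfl fun μ _ => hc μ,
      Finset.prod_const_one], ?_⟩
  change Matrix.toEuclideanCLM (𝕜 := ℂ) (tensorPow N (spinMatrix n g.1)) _ = _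
  rw [coherentN, Matrix.toEuclideanCLM_toLp, tensorPow_mulVec_prod, coherentN, ← WithLp.toLp_smul]
  congr 1
  funext m
  simp only [h, Pi.smul_apply, smul_eq_mul, Finset.prod_mul_distrib, rotate]

/-! ### Invariance of the measure -/

theorem rotateSphere_mul (R S : SO3) (Ω : Sphere2) :
    rotateSphere (R * S) Ω = rotateSphere R (rotateSphere S Ω) := by
  apply Subtype.ext
  simp [rotateSphere, Matrix.mulVec_mulVec]

theorem rotateSphere_one (Ω : Sphere2) : rotateSphere 1 Ω = Ω := by
  apply Subtype.ext
  simp [rotateSphere]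

theorem rotate_inv_rotate (N : ℕ) (R : SO3) (Ω : PhaseSpace N) :
    rotate N R⁻¹ (rotate N R Ω) = Ω := by
  funext μ
  simp only [rotate]
  rw [← rotateSphere_mul, inv_mul_cancel, rotateSphere_one]

/-- The isometry of `ℝ³` given by a rotation. -/
noncomputable def rotationIsometry (R : SO3) : EuclideanSpace ℝ (Fin 3) ≃ₗᵢ[ℝ] EuclideanSpace ℝ (Fin 3) :=
  -- The closing `rfl` is the equality of dimensions, from which surjectivity follows.
  LinearIsometry.toLinearIsometryEquiv
    { toLinearMap := (Matrix.toEuclideanCLM (𝕜 := ℝ) R.1).toLinearMap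
      norm_map' := norm_toLp_mulVec R } rfl

theorem continuous_rotateSphere (R : SO3) : Continuous (rotateSphere R) :=
  ((rotationIsometry R).continuous.comp continuous_subtype_val).subtype_mk _

-- By definition `toSphere` measures $s$ by the volume of the cone $(0,1)\cdot s$, times the
-- dimension. A linear isometry commutes with forming cones and preserves volume.
open scoped Pointwise in
theorem measurePreserving_rotateSphere (R : SO3) :
    MeasurePreserving (rotateSphere R)
      (volume : Measure (EuclideanSpace ℝ (Fin 3))).toSphere
      (volume : Measure (EuclideanSpace ℝ (Fin 3))).toSphere := by
  refine ⟨(continuous_rotateSphere R).measurable, ?_⟩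
  ext s hs
  have hm := (continuous_rotateSphere R).measurable hs
  rw [Measure.map_apply (continuous_rotateSphere R).measurable hs,
    Measure.toSphere_apply' _ hs, Measure.toSphere_apply' _ hm]
  congr 1
  rw [← (rotationIsometry R).measurePreserving.measure_preimage_equiv
    (f := (rotationIsometry R).toMeasurableEquiv) (Set.Ioo (0 : ℝ) 1 • (Subtype.val '' s))]
  -- What remains is an equality of sets: the cone over the preimage of $s$ is the preimage of the
  -- cone over $s$.
  congr 1
  ext v
  simp only [Set.mem_smul, Set.mem_image, Set.mem_preimage]
  constructor
  · rintro ⟨r, hr, _, ⟨Ω, hΩ, rfl⟩, rfl⟩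
    exact ⟨r, hr, _, ⟨_, hΩ, rfl⟩, ((rotationIsometry R).map_smul r Ω.1).symm⟩
  · rintro ⟨r, hr, _, ⟨Ω, hΩ, rfl⟩, h⟩
    -- If $Rv=r\Omega$ with $\Omega\in s$, then $v$ lies on the ray through $R^{-1}\Omega$.
    have hΩ' : rotateSphere R (rotateSphere R⁻¹ Ω) = Ω := by
      rw [← rotateSphere_mul, mul_inv_cancel, rotateSphere_one]
    refine ⟨r, hr, _, ⟨rotateSphere R⁻¹ Ω, by rwa [hΩ'], rfl⟩, ?_⟩
    apply (rotationIsometry R).injective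
    rw [map_smul]
    refine Eq.trans ?_ h
    exact congrArg (fun x : Sphere2 => r • x.1) hΩ'

theorem measurePreserving_rotate (n N : ℕ) (R : SO3) :
    MeasurePreserving (rotate N R) (phaseMeasure n N) (phaseMeasure n N) :=
  (measurePreserving_pi _ _ fun _ => measurePreserving_rotateSphere R).smul_measure _

/-! ### Contravariant matrices -/

theorem coeFn_coherentTransform (n N : ℕ) (φ : HilbertN n N) :
    coherentTransform n N φ =ᵐ[phaseMeasure n N] fun Ω => inner ℂ (coherentN n N Ω) φ :=
  (memLp_inner_coherentN n N φ).coeFn_toLp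

/-- The matrix elements of `A(F)`: `⟨φ|A(F)|ψ⟩ = ∫ F(Ω) ⟨φ|Ω⟩ ⟨Ω|ψ⟩`. -/
theorem inner_contravariantMatrix (n N : ℕ) (F : PhaseSpace N → ℂ)
    (hF : MemLp F ⊤ (phaseMeasure n N)) (φ ψ : HilbertN n N) :
    inner ℂ φ (contravariantMatrix n N (hF.toLp F) ψ) =
      ∫ Ω, F Ω * (inner ℂ φ (coherentN n N Ω) * inner ℂ (coherentN n N Ω) ψ)
        ∂phaseMeasure n N := by
  simp only [contravariantMatrix, ContinuousLinearMap.comp_apply]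
  rw [ContinuousLinearMap.adjoint_inner_right, L2.inner_def]
  refine integral_congr_ae ?_
  -- The elements of $L^2$ and $L^\infty$ are classes, so the integrands agree only almost
  -- everywhere.
  filter_upwards [coeFn_coherentTransform n N φ, coeFn_coherentTransform n N ψ,
    coeFn_multiplication n N (hF.toLp F) (coherentTransform n N ψ), hF.coeFn_toLp]
    with Ω h1 h2 h3 h4
  rw [h3, h1, h2, h4, RCLike.inner_apply, inner_conj_symm]
  ring

/-- In matrix elements this is $U_g|\Omega\rangle\langle\Omega|U_g^*=|R_g\Omega\rangle\langle
R_g\Omega|$. The coherent state enters once as a ket and once as a bra, so its phase contributes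
$\bar c c=1$. -/
theorem inner_adjoint_spinRep_coherentN (n N : ℕ) (g : SU2) (Ω : PhaseSpace N)
    (φ ψ : HilbertN n N) :
    inner ℂ ((spinRep n N g).1.adjoint φ) (coherentN n N Ω) *
        inner ℂ (coherentN n N Ω) ((spinRep n N g).1.adjoint ψ) =
      inner ℂ φ (coherentN n N (rotate N (inducedRotation g) Ω)) *
        inner ℂ (coherentN n N (rotate N (inducedRotation g) Ω)) ψ := by
  obtain ⟨c, hc, h⟩ := exists_phase_spinRep_coherentN n N g Ω
  rw [ContinuousLinearMap.adjoint_inner_left, ContinuousLinearMap.adjoint_inner_right, h,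
    inner_smul_left, inner_smul_right]
  have hc' : starRingEnd ℂ c * c = 1 := hc
  linear_combination (inner ℂ φ (coherentN n N (rotate N (inducedRotation g) Ω)) *
        inner ℂ (coherentN n N (rotate N (inducedRotation g) Ω)) ψ) * hc'

end SpinCoherent

/-! ### The covariance formula -/

theorem proposition5p2 (n N : ℕ) (g : SU2) (F : PhaseSpace N → ℂ)
    (hF : MeasureTheory.MemLp F ⊤ (phaseMeasure n N)) :
    ∃ hF' : MeasureTheory.MemLp (F ∘ rotate N (inducedRotation g)⁻¹) ⊤ (phaseMeasure n N),
      contravariantMatrix n N (hF'.toLp _) =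
        (spinRep n N g).1 ∘L contravariantMatrix n N (hF.toLp F) ∘L
          (spinRep n N g).1.adjoint := by
  -- Composition with a measure-preserving map keeps the essential bound.
  have hF' := hF.comp_measurePreserving (measurePreserving_rotate n N (inducedRotation g)⁻¹)
  refine ⟨hF', ?_⟩
  ext1 ψ
  refine ext_inner_left ℂ fun φ => ?_
  -- The outer $U_g$ is moved onto $\varphi$ as $U_g^*$, so that both sides become integrals of
  -- matrix elements.
  rw [ContinuousLinearMap.comp_apply, ContinuousLinearMap.comp_apply,
    ← ContinuousLinearMap.adjoint_inner_left (spinRep n N g).1, inner_contravariantMatrix,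
    inner_contravariantMatrix]
  have hR := measurePreserving_rotate n N (inducedRotation g)
  -- For an embedding, the change of variables requires no measurability of the integrand. The
  -- measurable inverse is the rotation by $R_g^{-1}$.
  have hemb : MeasurableEmbedding (rotate N (inducedRotation g)) :=
    MeasurableEmbedding.of_measurable_inverse hR.measurable
      (by
        have : Set.range (rotate N (inducedRotation g)) = Set.univ :=
          Set.range_eq_univ.mpr fun Ω => ⟨rotate N (inducedRotation g)⁻¹ Ω, by
            simpa using rotate_inv_rotate N (inducedRotation g)⁻¹ Ω⟩
        rw [this]; exact MeasurableSet.univ)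
      (measurePreserving_rotate n N (inducedRotation g)⁻¹).measurable
      (rotate_inv_rotate N (inducedRotation g))
  -- Substituting $R_g\Omega$ for $\Omega$ on the left turns $F\circ R_g^{-1}$ into $F$ and each
  -- $|\Omega\rangle$ into $|R_g\Omega\rangle$.
  rw [← hR.integral_comp hemb]
  simp only [Function.comp_apply, rotate_inv_rotate, inner_adjoint_spinRep_coherentN]
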